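/- **Setting.** Let $\Sigma$ be the set of program states, i.e. of mappings from variable names to values. A *run* from a state is a finite sequence of transitions, marked as terminated, aborted or incomplete, or an infinite sequence of transitions; each transition is a program ($\pi$) or an environment ($\epsilon$) transition and leads to a state. A *trace* is an initial state together with a run from it. A *command* is a set of such (Aczel) traces that contains the empty incomplete trace from every state, is closed under taking incomplete finite prefixes, and contains every extension of a finite transition sequence after which it can abort. Commands, ordered by inclusion, form a complete lattice; $c \succeq d$ ("$c$ is refined by $d$") means $c \supseteq d$; $\vee$ and $\bigvee$ are joins; the greatest command $\lightning$ (abort) contains all traces. Write $\overline{x}$ for complement. * Primitive commands: for a set of states $p$, $\tau(p)$ terminates immediately from states in $p$ and is infeasible otherwise; for a relation $r \subseteq \Sigma\times\Sigma$, $\pi(r)$ and $\epsilon(r)$ perform a single program, respectively environment, transition satisfying $r$ and terminate (infeasible if there is none). * $c \mathbin{;} d$ (sequential composition, binding tightest after framing) consists of the non-terminated traces of $c$, all extensions of the aborted traces of $c$, and the terminated traces of $c$ continued by a trace of $d$. $c \Cap d$ (weak conjunction) consists of the common traces of $c$ and $d$, together with all extensions of any finite transition sequence after which one of $c$, $d$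 can abort and which is an incomplete trace of the other. * $c^{\star}$ and $c^{\omega}$ are the least and greatest fixed points of $y \mapsto \boldsymbol\tau \vee c \mathbin{;} y$, where $\boldsymbol\tau = \tau(\Sigma)$. Put $\alpha(r) = \pi(r) \vee \epsilon(r)$, and let $\mathsf{univ} = \Sigma\times\Sigma$. * Derived commands: $\{p\} = \boldsymbol\tau \vee \tau(\overline p) \mathbin{;} \lightning$; $\ \mathsf{guar}\, g = (\pi(g) \vee \epsilon(\mathsf{univ}))^{\omega}$; $\ \mathsf{rely}\, r = (\alpha(\mathsf{univ}) \vee \epsilon(\overline r) \mathbin{;} \lightning)^{\omega}$; $\ \mathsf{term} = \alpha(\mathsf{univ})^{\star} \mathbin{;} \epsilon(\mathsf{univ})^{\omega}$; $\ \mathsf{opt}\, q = \pi(q) \vee \tau(\{\sigma \mid (\sigma,\sigma) \in q\})$; $\ [q] = \bigvee_{\sigma_0 \in \Sigma} \tau(\{\sigma_0\}) \mathbin{;} \mathsf{term} \mathbin{;} \tau(\{\sigma \mid (\sigma_0,\sigma) \in q\})$. For a set $x$ of variables, $\mathsf{id}(x)$ is the relation "no variable in $x$ changes", and $x : c = \mathsf{guar}(\mathsf{id}(\overline{x}))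 \Cap c$. * For a set of states $p$, $\mathsf{pre}\, p = \{(\sigma_0,\sigma) \mid \sigma_0 \in p\}$ and $\mathsf{post}\, p = \{(\sigma_0,\sigma) \mid \sigma \in p\}$. For a set of states $I$ (the coupling invariant), $\mathsf{inv}\, I = \{I\} \mathbin{;} \alpha(\mathsf{post}\, I)^{\omega}$, and $c \succeq_I d$ ("$d$ is a data reification of $c$ under $I$") means $\mathsf{inv}\, I \Cap c \succeq \mathsf{inv}\, I \Cap d$. **Lemma (reify-commands).** Let $I \subseteq \Sigma$. For all sets of states $p, p_1, p_2$, all relations $g, g_1, g_2, q_1, q_2, r_1, r_2$ on states, all sets of variables $v, w$ and every command $c$: \begin{align*} \tau(p_1) &\succeq_I \tau(p_2) && \text{if } p_1 \supseteq I \cap p_2,\\ \pi(r_1) &\succeq_I \pi(r_2) && \text{if } r_1 \supseteq \mathsf{pre}\, I \cap r_2 \cap \mathsf{post}\, I,\\ \epsilon(r_1) &\succeq_I \epsilon(r_2) && \text{if } r_1 \supseteq \mathsf{pre}\, I \cap r_2 \cap \mathsf{post}\, I,\\ \{p_1\} &\succeq_I \{p_2\} && \text{if } I \cap p_1 \subseteq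 p_2,\\ \mathsf{guar}\, g_1 &\succeq_I \mathsf{guar}\, g_2 && \text{if } g_1 \supseteq \mathsf{pre}\, I \cap g_2 \cap \mathsf{post}\, I,\\ \mathsf{rely}\, r_1 &\succeq_I \mathsf{rely}\, r_2 && \text{if } \mathsf{pre}\, I \cap r_1 \cap \mathsf{post}\, I \subseteq r_2,\\ w : c &\succeq_I \mathsf{guar}\, g \Cap (v \cup w) : c && \text{if } \mathsf{id}(v) \supseteq \mathsf{pre}\, I \cap g \cap \mathsf{post}\, I \text{ and } v \neq w,\\ \mathsf{opt}\, q_1 &\succeq_I \mathsf{opt}\, q_2 && \text{if } q_1 \supseteq \mathsf{pre}\, I \cap q_2 \cap \mathsf{post}\, I,\\ \{p\} \mathbin{;} [q_1] &\succeq_I \{I \cap p\} \mathbin{;} [q_2] && \text{if } q_1 \supseteq \mathsf{pre}\, I \cap \mathsf{pre}\, p \cap q_2 \cap \mathsf{post}\, I. \end{align*} -/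

import Mathlib

namespace RelyGuarantee

universe u v

/-! ### Aczel traces -/

/-- A transition is either a program transition or an environment transition. -/
inductive Kind : Type
  | prog
  | env

/-- How a finite trace ends: by terminating, by aborting, or because it has been observed only
up to that point (or is infeasible beyond it). -/
inductive Ending : Type
  | terminated
  | aborted
  | incomplete

/-- An Aczel trace with its initial state removed: a finite sequence of transitions together with
the way it ends, or an infinite sequence of transitions.  A transition is recorded by its kind and
by the state that it leads to. -/
inductive Run (S : Type u) : Type u
  | finite (steps : List (Kind × S)) (e : Ending) : Run S
  | infinite (steps : Stream' (Kind × S)) : Run S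

variable {S : Type u}

/-- Put finitely many transitions in front of a run. -/
def Run.prepend (s : List (Kind × S)) : Run S → Run S
  | .finite t e => .finite (s ++ t) e
  | .infinite f => .infinite (s ++ₛ f)

/-- The run is a finite one that ends by terminating. -/
def Run.IsTerminated : Run S → Prop
  | .finite _ .terminated => True
  | _ => False

/-- The state reached from `σ` by a finite sequence of transitions. -/
def lastState (σ : S) (s : List (Kind × S)) : S :=
  (s.getLast?.map Prod.snd).getD σ

theorem Run.prepend_nil (ρ : Run S) : ρ.prepend [] = ρ := by
  cases ρ <;> rfl

theorem Run.prepend_append (s t : List (Kind × S)) (ρ : Run S) :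
    ρ.prepend (s ++ t) = (ρ.prepend t).prepend s := by
  cases ρ <;> simp [Run.prepend]

theorem Run.prepend_cons_inj {a b : Kind × S} {s t : List (Kind × S)} {ρ ρ' : Run S}
    (h : ρ.prepend (a :: s) = ρ'.prepend (b :: t)) :
    a = b ∧ ρ.prepend s = ρ'.prepend t := by
  cases ρ <;> cases ρ' <;> simp only [Run.prepend, reduceCtorEq] at h
  · simp_all [Run.prepend]
  · simp only [Run.infinite.injEq, Stream'.cons_append_stream] at h
    have h1 := congrArg Stream'.head h
    have h2 := congrArg Stream'.tail h
    simp only [Stream'.head_cons, Stream'.tail_cons] at h1 h2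
    exact ⟨h1, by simp [Run.prepend, h2]⟩

/-- Of two finite initial parts of one run, one extends the other. -/
theorem Run.prepend_eq_prepend {s t : List (Kind × S)} {ρ ρ' : Run S}
    (h : ρ.prepend s = ρ'.prepend t) :
    (∃ r, s = t ++ r ∧ ρ' = ρ.prepend r) ∨ (∃ r, t = s ++ r ∧ ρ = ρ'.prepend r) := by
  induction s generalizing t with
  | nil => exact Or.inr ⟨t, rfl, by rwa [Run.prepend_nil] at h⟩
  | cons a s ih =>
    cases t with
    | nil => exact Or.inl ⟨a :: s, rfl, by rw [Run.prepend_nil] at h; exact h.symm⟩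
    | cons b t =>
      obtain ⟨rfl, h'⟩ := Run.prepend_cons_inj h
      rcases ih h' with ⟨r, rfl, hr⟩ | ⟨r, rfl, hr⟩
      · exact Or.inl ⟨r, rfl, hr⟩
      · exact Or.inr ⟨r, rfl, hr⟩

/-! ### Commands -/

/-- A command over the state space `S`: a set of Aczel traces, given as the set of runs from each
initial state.  From every state the empty observation is possible, every finite initial part of a
run is a possible (incomplete) observation, and anything may follow once a command has aborted. -/
@[ext]
structure Cmd (S : Type u) : Type u where
  runs : S → Set (Run S)
  start_mem : ∀ σ, Run.finite [] .incomplete ∈ runs σ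
  prefix_mem : ∀ σ s ρ, Run.prepend s ρ ∈ runs σ → Run.finite s .incomplete ∈ runs σ
  abort_mem : ∀ σ s ρ, Run.finite s .aborted ∈ runs σ → Run.prepend s ρ ∈ runs σ

namespace Cmd

theorem eq_nil_of_prepend {s : List (Kind × S)} {ρ : Run S} {e : Ending}
    (h : ρ.prepend s = .finite [] e) : s = [] := by
  cases ρ <;> simp_all [Run.prepend]

/-- `c ≤ d` says that every trace of `c` is a trace of `d`: the command `d` is refined by `c`. -/
instance : PartialOrder (Cmd S) where
  le c d := ∀ σ, c.runs σ ⊆ d.runs σ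
  le_refl _ _ := subset_rfl
  le_trans _ _ _ h h' σ := (h σ).trans (h' σ)
  le_antisymm _ _ h h' := Cmd.ext (funext fun σ => (h σ).antisymm (h' σ))

/-- Commands ordered by inclusion of their sets of traces form a complete lattice.  Joins are
non-deterministic choices, meets are strong conjunctions, the greatest command aborts immediately,
and the least command is everywhere infeasible. -/
instance : CompleteLattice (Cmd S) where
  sup c d :=
    { runs := fun σ => c.runs σ ∪ d.runs σ
      start_mem := fun σ => Or.inl (c.start_mem σ)
      prefix_mem := fun σ s ρ h => h.imp (c.prefix_mem σ s ρ) (d.prefix_mem σ s ρ)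
      abort_mem := fun σ s ρ h => h.imp (c.abort_mem σ s ρ) (d.abort_mem σ s ρ) }
  le_sup_left _ _ _ := Set.subset_union_left
  le_sup_right _ _ _ := Set.subset_union_right
  sup_le _ _ _ h h' σ := Set.union_subset (h σ) (h' σ)
  inf c d :=
    { runs := fun σ => c.runs σ ∩ d.runs σ
      start_mem := fun σ => ⟨c.start_mem σ, d.start_mem σ⟩
      prefix_mem := fun σ s ρ h => ⟨c.prefix_mem σ s ρ h.1, d.prefix_mem σ s ρ h.2⟩
      abort_mem := fun σ s ρ h => ⟨c.abort_mem σ s ρ h.1, d.abort_mem σ s ρ h.2⟩ }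
  inf_le_left _ _ _ := Set.inter_subset_left
  inf_le_right _ _ _ := Set.inter_subset_right
  le_inf _ _ _ h h' σ := Set.subset_inter (h σ) (h' σ)
  top :=
    { runs := fun _ => Set.univ
      start_mem := fun _ => trivial
      prefix_mem := fun _ _ _ _ => trivial
      abort_mem := fun _ _ _ _ => trivial }
  le_top _ _ := Set.subset_univ _
  bot :=
    { runs := fun _ => {Run.finite [] .incomplete}
      start_mem := fun _ => rfl
      prefix_mem := fun _ _ _ h => by rw [eq_nil_of_prepend h]; rfl
      abort_mem := fun _ _ _ h => by simp at h }
  bot_le c σ := Set.singleton_subset_iff.2 (c.start_mem σ)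
  sSup C :=
    { runs := fun σ => {Run.finite [] .incomplete} ∪ {ρ | ∃ c ∈ C, ρ ∈ c.runs σ}
      start_mem := fun _ => Or.inl rfl
      prefix_mem := fun σ s ρ h => by
        rcases h with h | ⟨c, hc, h⟩
        · rw [eq_nil_of_prepend h]; exact Or.inl rfl
        · exact Or.inr ⟨c, hc, c.prefix_mem σ s ρ h⟩
      abort_mem := fun σ s ρ h => by
        rcases h with h | ⟨c, hc, h⟩
        · simp at h
        · exact Or.inr ⟨c, hc, c.abort_mem σ s ρ h⟩ }
  isLUB_sSup C :=
    ⟨fun c hc _ _ h => Or.inr ⟨c, hc, h⟩, fun d hd σ ρ h => by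
      rcases h with h | ⟨c, hc, h⟩
      · rw [Set.mem_singleton_iff.1 h]; exact d.start_mem σ
      · exact hd hc σ h⟩
  sInf C :=
    { runs := fun σ => {ρ | ∀ c ∈ C, ρ ∈ c.runs σ}
      start_mem := fun σ c _ => c.start_mem σ
      prefix_mem := fun σ s ρ h c hc => c.prefix_mem σ s ρ (h c hc)
      abort_mem := fun σ s ρ h c hc => c.abort_mem σ s ρ (h c hc) }
  isGLB_sInf C :=
    ⟨fun c hc _ _ h => h c hc, fun _ hd σ _ h _ hc => hd hc σ h⟩

/-! ### Primitive commands -/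

/-- Dijkstra's abort command. -/
def abort : Cmd S := ⊤

/-- The instantaneous test `τ p`: terminates at once if the state is in `p`, and is infeasible
otherwise. -/
def test (p : Set S) : Cmd S where
  runs σ := {Run.finite [] .incomplete} ∪ {ρ | σ ∈ p ∧ ρ = .finite [] .terminated}
  start_mem _ := Or.inl rfl
  prefix_mem σ s ρ h := by
    rcases h with h | ⟨_, h⟩ <;> rw [eq_nil_of_prepend h] <;> exact Or.inl rfl
  abort_mem σ s ρ h := by simp at h

/-- A single transition of kind `k` that satisfies the relation `r`. -/
def atom (k : Kind) (r : Set (S × S)) : Cmd S where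
  runs σ := {Run.finite [] .incomplete} ∪
    {ρ | ∃ σ', (σ, σ') ∈ r ∧
      (ρ = .finite [(k, σ')] .incomplete ∨ ρ = .finite [(k, σ')] .terminated)}
  start_mem _ := Or.inl rfl
  prefix_mem σ s ρ h := by
    rcases h with h | ⟨σ', hr, h⟩
    · rw [eq_nil_of_prepend h]; exact Or.inl rfl
    · cases s with
      | nil => exact Or.inl rfl
      | cons a s =>
        cases ρ with
        | infinite f => simp [Run.prepend] at h
        | finite t e =>
          simp only [Run.prepend, List.cons_append, Run.finite.injEq, List.cons.injEq,
            List.append_eq_nil_iff] at h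
          refine Or.inr ⟨σ', hr, Or.inl ?_⟩
          rcases h with ⟨⟨h1, h2, _⟩, _⟩ | ⟨⟨h1, h2, _⟩, _⟩ <;> rw [h1, h2]
  abort_mem σ s ρ h := by simp at h

/-- The atomic program command `π r`. -/
def pstep (r : Set (S × S)) : Cmd S := atom .prog r

/-- The atomic environment command `ε r`. -/
def estep (r : Set (S × S)) : Cmd S := atom .env r

/-! ### Sequential composition and weak conjunction -/

/-- Sequential composition `c ; d`: a trace of `c` that does not terminate (an aborting one may
continue arbitrarily), or a terminating trace of `c` followed by a trace of `d`. -/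
def seq (c d : Cmd S) : Cmd S where
  runs σ := {ρ | ρ ∈ c.runs σ ∧ ¬ ρ.IsTerminated} ∪
    {ρ | ∃ s ρ', Run.finite s .aborted ∈ c.runs σ ∧ ρ = Run.prepend s ρ'} ∪
    {ρ | ∃ s ρ', Run.finite s .terminated ∈ c.runs σ ∧ ρ' ∈ d.runs (lastState σ s) ∧
      ρ = Run.prepend s ρ'}
  start_mem σ := Or.inl (Or.inl ⟨c.start_mem σ, id⟩)
  prefix_mem σ s ρ h := by
    rcases h with (⟨h, _⟩ | ⟨s', ρ', h, e⟩) | ⟨s', ρ', h, h', e⟩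
    · exact Or.inl (Or.inl ⟨c.prefix_mem σ s ρ h, id⟩)
    · exact Or.inl (Or.inl ⟨c.prefix_mem σ s ρ (e ▸ c.abort_mem σ s' ρ' h), id⟩)
    · rcases Run.prepend_eq_prepend e with ⟨r, rfl, hr⟩ | ⟨r, rfl, _⟩
      · refine Or.inr ⟨s', .finite r .incomplete, h, ?_, rfl⟩
        exact d.prefix_mem _ r ρ (hr ▸ h')
      · refine Or.inl (Or.inl ⟨c.prefix_mem σ s (.finite r .terminated) h, id⟩)
  abort_mem σ s ρ h := by
    rcases h with (⟨h, _⟩ | ⟨s', ρ', h, e⟩) | ⟨s', ρ', h, h', e⟩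
    · exact Or.inl (Or.inr ⟨s, ρ, h, rfl⟩)
    · cases ρ' with
      | infinite f => simp [Run.prepend] at e
      | finite t x =>
        simp only [Run.prepend, Run.finite.injEq] at e
        exact Or.inl (Or.inr ⟨s', Run.prepend t ρ, h, by rw [e.1, Run.prepend_append]⟩)
    · cases ρ' with
      | infinite f => simp [Run.prepend] at e
      | finite t x =>
        simp only [Run.prepend, Run.finite.injEq] at e
        refine Or.inr ⟨s', Run.prepend t ρ, h, d.abort_mem _ t ρ ?_, ?_⟩
        · rw [e.2]; exact h'
        · rw [e.1, Run.prepend_append]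

/-- Weak conjunction `c ⋒ d`: a common trace of `c` and `d`, unless one of them aborts at a point
that the other can reach; from there on the weak conjunction aborts. -/
def wconj (c d : Cmd S) : Cmd S where
  runs σ := {ρ | ρ ∈ c.runs σ ∧ ρ ∈ d.runs σ} ∪
    {ρ | ∃ s ρ', ρ = Run.prepend s ρ' ∧
      ((Run.finite s .aborted ∈ c.runs σ ∧ Run.finite s .incomplete ∈ d.runs σ) ∨
       (Run.finite s .incomplete ∈ c.runs σ ∧ Run.finite s .aborted ∈ d.runs σ))}
  start_mem σ := Or.inl ⟨c.start_mem σ, d.start_mem σ⟩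
  prefix_mem σ s ρ h := by
    rcases h with ⟨h, h'⟩ | ⟨s', ρ', e, h⟩
    · exact Or.inl ⟨c.prefix_mem σ s ρ h, d.prefix_mem σ s ρ h'⟩
    · rcases Run.prepend_eq_prepend e with ⟨r, rfl, _⟩ | ⟨r, rfl, _⟩
      · exact Or.inr ⟨s', .finite r .incomplete, rfl, h⟩
      · refine Or.inl ?_
        rcases h with ⟨h1, h2⟩ | ⟨h1, h2⟩
        · exact ⟨c.prefix_mem σ s (.finite r .aborted) h1,
            d.prefix_mem σ s (.finite r .incomplete) h2⟩
        · exact ⟨c.prefix_mem σ s (.finite r .incomplete) h1,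
            d.prefix_mem σ s (.finite r .aborted) h2⟩
  abort_mem σ s ρ h := by
    rcases h with ⟨h, h'⟩ | ⟨s', ρ', e, h⟩
    · exact Or.inl ⟨c.abort_mem σ s ρ h, d.abort_mem σ s ρ h'⟩
    · cases ρ' with
      | infinite f => simp [Run.prepend] at e
      | finite t x =>
        simp only [Run.prepend, Run.finite.injEq] at e
        exact Or.inr ⟨s', Run.prepend t ρ, by rw [e.1, Run.prepend_append], h⟩

end Cmd

infixl:75 " ⨟ " => Cmd.seq
infixl:70 " ⋒ " => Cmd.wconj

namespace Cmd

theorem seq_mono_right (c : Cmd S) {d d' : Cmd S} (h : d ≤ d') : c ⨟ d ≤ c ⨟ d' := by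
  intro σ ρ hρ
  rcases hρ with hρ | ⟨s, ρ', h1, h2, e⟩
  · exact Or.inl hρ
  · exact Or.inr ⟨s, ρ', h1, h _ h2, e⟩

/-! ### Derived commands -/

/-- The command `τ` that terminates immediately from every state. -/
def nil : Cmd S := test Set.univ

/-- The assertion `{p}`: aborts unless the state is in `p`. -/
def assert (p : Set S) : Cmd S := nil ⊔ test pᶜ ⨟ abort

/-- The command `α r`: one program or environment transition satisfying `r`. -/
def step (r : Set (S × S)) : Cmd S := pstep r ⊔ estep r

/-- The monotone function `y ↦ τ ∨ c ; y`. -/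
def iterFun (c : Cmd S) : Cmd S →o Cmd S where
  toFun y := nil ⊔ c ⨟ y
  monotone' _ _ h := sup_le_sup_left (seq_mono_right c h) _

/-- Finite iteration: the least fixed point of `y ↦ τ ∨ c ; y`. -/
def finIter (c : Cmd S) : Cmd S := (iterFun c).lfp

/-- Possibly infinite iteration: the greatest fixed point of `y ↦ τ ∨ c ; y`. -/
def iter (c : Cmd S) : Cmd S := (iterFun c).gfp

/-- The program guarantee `guar g`: every program transition satisfies `g`. -/
def guar (g : Set (S × S)) : Cmd S := iter (pstep g ⊔ estep Set.univ)

/-- The rely command `rely r`: aborts after an environment transition that does not satisfy `r`. -/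
def rely (r : Set (S × S)) : Cmd S := iter (step Set.univ ⊔ estep rᶜ ⨟ abort)

/-- The command `term`: finitely many program transitions, any environment transitions. -/
def term : Cmd S := finIter (step Set.univ) ⨟ iter (estep Set.univ)

/-- The optional step `opt q`. -/
def opt (q : Set (S × S)) : Cmd S := pstep q ⊔ test {σ | (σ, σ) ∈ q}

/-- The postcondition specification `[q]`. -/
def post (q : Set (S × S)) : Cmd S :=
  ⨆ σ₀ : S, test {σ₀} ⨟ term ⨟ test {σ | (σ₀, σ) ∈ q}

/-- Every transition, of the program or of the environment, satisfies `r`. -/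
def promise (r : Set (S × S)) : Cmd S := iter (step r)

end Cmd

/-! ### Invariants and data reification -/

/-- The relation of pairs of states whose initial state is in `p`. -/
def preRel (p : Set S) : Set (S × S) := {x | x.1 ∈ p}

/-- The relation of pairs of states whose final state is in `p`. -/
def postRel (p : Set S) : Set (S × S) := {x | x.2 ∈ p}

/-- The invariant command `inv I = {I} ; promise (post I)`. -/
def Cmd.inv (I : Set S) : Cmd S := Cmd.assert I ⨟ Cmd.promise (postRel I)

/-- `DataReif I c d`: the command `d` is a data reification of `c` under the coupling invariant `I`,
that is, `inv I ⋒ c` is refined by `inv I ⋒ d`. -/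
def DataReif (I : Set S) (c d : Cmd S) : Prop := Cmd.inv I ⋒ c ≥ Cmd.inv I ⋒ d

/-! ### Program states and frames -/

/-- Program states map variable names to values. -/
abbrev State (Var : Type u) (Val : Type v) : Type (max u v) := Var → Val

/-- The identity relation on a set `x` of variables: no variable in `x` changes. -/
def idRel {Var : Type u} {Val : Type v} (x : Set Var) : Set (State Var Val × State Var Val) :=
  {y | ∀ a ∈ x, y.1 a = y.2 a}

/-- The framed command `x : c`: program transitions of `c` may modify only variables in `x`. -/
def Cmd.frame {Var : Type u} {Val : Type v} (x : Set Var) (c : Cmd (State Var Val)) :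
    Cmd (State Var Val) :=
  Cmd.guar (idRel xᶜ) ⋒ c

end RelyGuarantee

namespace RelyGuarantee

universe u v

variable {S : Type u}

/-! From a state outside `I`, `inv I` aborts at once, so `inv I ⋒ c` has every run and nothing is
left to check. From a state in `I`, `inv I` never aborts, and its runs visit only states of `I`. So
`d` reifies `c` as soon as every run of `d` that starts and stays in `I` is a run of `c`, which is
the inequality `restrict I d ≤ c` (`dataReif_of_restrict_le`).

This inequality is compositional: it passes through joins, sequential composition, weak conjunction
with a fixed command and, by coinduction, iteration. Since the derived commands are built from tests
and atomic steps, most of the claims reduce to `restrict_test_le` and `restrict_atom_le`, where the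
hypotheses enter. Two claims need more: `[q]` must be localised to its own initial state
(`mem_post`), and framing needs two guarantees merged into one (`guar_wconj_guar_wconj_le`). -/

/-- Every transition of the run leads to a state in `I`. -/
def Run.StaysIn (I : Set S) (ρ : Run S) : Prop :=
  ∀ s ρ', ρ = Run.prepend s ρ' → ∀ x ∈ s, x.2 ∈ I

theorem Run.staysIn_finite {I : Set S} {s : List (Kind × S)} {e : Ending} :
    (Run.finite s e).StaysIn I ↔ ∀ x ∈ s, x.2 ∈ I := by
  constructor
  · intro h
    exact h s (.finite [] e) (by simp [Run.prepend])
  · rintro h t (⟨r, e'⟩ | f) heq x hx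
    · simp only [Run.prepend, Run.finite.injEq] at heq
      exact h x (heq.1 ▸ List.mem_append_left r hx)
    · simp [Run.prepend] at heq

theorem Run.staysIn_prepend {I : Set S} {s : List (Kind × S)} {ρ : Run S} :
    (ρ.prepend s).StaysIn I ↔ (∀ x ∈ s, x.2 ∈ I) ∧ ρ.StaysIn I := by
  constructor
  · refine fun h => ⟨h s ρ rfl, fun t ρ' heq x hx => ?_⟩
    exact h (s ++ t) ρ' (by rw [Run.prepend_append, heq]) x (List.mem_append_right s hx)
  · rintro ⟨h, h'⟩ t ρ' heq x hx
    rcases Run.prepend_eq_prepend heq with ⟨r, rfl, _⟩ | ⟨r, rfl, hr⟩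
    · exact h x (List.mem_append_left r hx)
    · rcases List.mem_append.1 hx with hx | hx
      · exact h x hx
      · exact h' r ρ' hr x hx

/-- Lets the second command of a sequential composition start in `I` again. The hypothesis on `σ`
covers the empty sequence, whose last state is `σ`. -/
theorem lastState_mem {I : Set S} {σ : S} {s : List (Kind × S)} (hσ : σ ∈ I)
    (h : ∀ x ∈ s, x.2 ∈ I) : lastState σ s ∈ I := by
  unfold lastState
  cases hs : s.getLast? with
  | none => exact hσ
  | some x => exact h x (List.mem_of_getLast? hs)

namespace Cmd

/-! ### Membership in derived commands -/

theorem iter_unfold (c : Cmd S) : iter c = nil ⊔ c ⨟ iter c :=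
  ((iterFun c).map_gfp).symm

theorem eq_of_mem_test {p : Set S} {σ : S} {ρ : Run S} (h : ρ ∈ (test p).runs σ) :
    ρ = .finite [] .incomplete ∨ (σ ∈ p ∧ ρ = .finite [] .terminated) := h

theorem mem_assert_of_notMem {p : Set S} {σ : S} (h : σ ∉ p) (ρ : Run S) :
    ρ ∈ (assert p).runs σ :=
  Or.inr (Or.inr ⟨[], ρ, Or.inr ⟨h, rfl⟩, trivial, (Run.prepend_nil ρ).symm⟩)

/-- Prefixing a test that fails leaves only the empty observation. -/
theorem eq_of_mem_seq {c d : Cmd S} {σ : S}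
    (hc : ∀ ρ ∈ c.runs σ, ρ = Run.finite [] .incomplete) {ρ : Run S}
    (h : ρ ∈ (c ⨟ d).runs σ) : ρ = .finite [] .incomplete := by
  rcases h with (⟨h, _⟩ | ⟨s, ρ', h, _⟩) | ⟨s, ρ', h, _⟩
  · exact hc _ h
  · simpa using hc _ h
  · simpa using hc _ h

theorem eq_of_mem_assert {p : Set S} {σ : S} (hσ : σ ∈ p) {ρ : Run S}
    (h : ρ ∈ (assert p).runs σ) :
    ρ = .finite [] .incomplete ∨ ρ = .finite [] .terminated := by
  rcases h with h | h
  · exact (eq_of_mem_test h).imp_right And.right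
  · refine Or.inl (eq_of_mem_seq (fun ρ h => ?_) h)
    exact (eq_of_mem_test h).resolve_right fun h' => h'.1 hσ

theorem mem_assert_seq_of_notMem {p : Set S} {σ : S} (hσ : σ ∉ p) (c : Cmd S) (ρ : Run S) :
    ρ ∈ (assert p ⨟ c).runs σ :=
  Or.inl (Or.inr ⟨[], ρ, mem_assert_of_notMem hσ _, (Run.prepend_nil ρ).symm⟩)

/-- From a state that satisfies it, an assertion has no effect. -/
theorem mem_assert_seq_iff {p : Set S} {σ : S} (hσ : σ ∈ p) {c : Cmd S} {ρ : Run S} :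
    ρ ∈ (assert p ⨟ c).runs σ ↔ ρ ∈ c.runs σ := by
  constructor
  · rintro ((⟨h, h'⟩ | ⟨s, ρ', h, _⟩) | ⟨s, ρ', h, h', rfl⟩)
    · rcases eq_of_mem_assert hσ h with rfl | rfl
      · exact c.start_mem σ
      · exact absurd trivial h'
    · simpa using eq_of_mem_assert hσ h
    · have hs : s = [] := by simpa using eq_of_mem_assert hσ h
      subst hs
      rwa [Run.prepend_nil]
  · intro h
    exact Or.inr ⟨[], ρ, Or.inl (Or.inr ⟨trivial, rfl⟩), h, (Run.prepend_nil ρ).symm⟩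

/-! ### Iterations of atomic commands. -/

/-- Every run of `c` consists of at most one transition, which satisfies `R`, and does not abort. -/
def IsAtomic (R : S → Kind × S → Prop) (c : Cmd S) : Prop :=
  ∀ σ, ∀ ρ ∈ c.runs σ, ρ = .finite [] .incomplete ∨ ∃ a : Kind × S, R σ a ∧
    (ρ = .finite [a] .incomplete ∨ ρ = .finite [a] .terminated)

theorem isAtomic_atom (k : Kind) (r : Set (S × S)) :
    IsAtomic (fun σ a => a.1 = k ∧ (σ, a.2) ∈ r) (atom k r) := by
  rintro σ ρ (h | ⟨σ', h, h'⟩)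
  · exact Or.inl h
  · exact Or.inr ⟨(k, σ'), ⟨rfl, h⟩, h'⟩

theorem IsAtomic.sup {R R' : S → Kind × S → Prop} {c c' : Cmd S} (h : IsAtomic R c)
    (h' : IsAtomic R' c') : IsAtomic (fun σ a => R σ a ∨ R' σ a) (c ⊔ c') := by
  rintro σ ρ (hρ | hρ)
  · exact (h σ ρ hρ).imp_right fun ⟨a, ha, e⟩ => ⟨a, Or.inl ha, e⟩
  · exact (h' σ ρ hρ).imp_right fun ⟨a, ha, e⟩ => ⟨a, Or.inr ha, e⟩

/-- An atomic command cannot terminate without a transition, so each unfolding of the fixed point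
exposes one. If the command stops incomplete after it, the remainder is the empty observation, which
belongs to every command. -/
theorem IsAtomic.mem_iter_cases {R : S → Kind × S → Prop} {c : Cmd S} (hc : IsAtomic R c)
    {σ : S} {ρ : Run S} (h : ρ ∈ (iter c).runs σ) :
    ρ = .finite [] .incomplete ∨ ρ = .finite [] .terminated ∨
      ∃ (a : Kind × S) (ρ' : Run S), R σ a ∧ ρ = ρ'.prepend [a] ∧
        ρ' ∈ (iter c).runs a.2 := by
  rw [iter_unfold] at h
  rcases h with h | (⟨h, h'⟩ | ⟨s, ρ', h, rfl⟩) | ⟨s, ρ', h, h', rfl⟩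
  · rcases eq_of_mem_test h with h | h
    · exact Or.inl h
    · exact Or.inr (Or.inl h.2)
  · rcases hc _ _ h with h | ⟨a, ha, rfl | rfl⟩
    · exact Or.inl h
    · exact Or.inr (Or.inr ⟨a, .finite [] .incomplete, ha, rfl, start_mem _ _⟩)
    · exact absurd trivial h'
  · simpa using hc _ _ h
  · rcases hc _ _ h with h | ⟨a, ha, h | h⟩
    · simp at h
    · simp at h
    · simp only [Run.finite.injEq, and_true] at h
      subst h
      exact Or.inr (Or.inr ⟨a, ρ', ha, rfl, h'⟩)

/-- Although `iter` is a greatest fixed point, each unfolding uses up one transition, so induction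
on the finite sequence suffices. Atomicity matters: `iter nil` is `⊤`, which aborts. -/
theorem IsAtomic.aborted_notMem_iter {R : S → Kind × S → Prop} {c : Cmd S}
    (hc : IsAtomic R c) {σ : S} (s : List (Kind × S)) :
    Run.finite s .aborted ∉ (iter c).runs σ := by
  intro h
  induction s generalizing σ with
  | nil =>
    rcases hc.mem_iter_cases h with h | h | ⟨a, ρ', _, heq, _⟩
    · simp at h
    · simp at h
    · simpa using eq_nil_of_prepend heq.symm
  | cons b s ih =>
    rcases hc.mem_iter_cases h with h | h | ⟨a, ρ', _, heq, h⟩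
    · simp at h
    · simp at h
    · have heq' : (Run.finite [] .aborted).prepend (b :: s) = ρ'.prepend [a] := by
        simpa [Run.prepend] using heq
      obtain ⟨rfl, htail⟩ := Run.prepend_cons_inj heq'
      rw [Run.prepend_nil] at htail
      subst htail
      exact ih (by simpa [Run.prepend] using h)

theorem isAtomic_step (r : Set (S × S)) : IsAtomic (fun σ a => (σ, a.2) ∈ r) (step r) := by
  intro σ ρ hρ
  exact ((isAtomic_atom .prog r).sup (isAtomic_atom .env r) σ ρ hρ).imp_right
    fun ⟨a, ha, e⟩ => ⟨a, ha.elim And.right And.right, e⟩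

theorem isAtomic_guar (g : Set (S × S)) :
    IsAtomic (fun σ a => (a.1 = .prog ∧ (σ, a.2) ∈ g) ∨ a.1 = .env)
      (pstep g ⊔ estep Set.univ) := by
  intro σ ρ hρ
  exact ((isAtomic_atom .prog g).sup (isAtomic_atom .env Set.univ) σ ρ hρ).imp_right
    fun ⟨a, ha, e⟩ => ⟨a, ha.imp_right And.left, e⟩

/-- Infinite runs need no coinduction, because `Run.StaysIn` looks only at finite initial parts. -/
theorem staysIn_of_mem_promise {I : Set S} {σ : S} {ρ : Run S}
    (h : ρ ∈ (promise (postRel I)).runs σ) : ρ.StaysIn I := by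
  rintro s ρ' rfl
  induction s generalizing σ with
  | nil => simp
  | cons b s ih =>
    rcases (isAtomic_step _).mem_iter_cases h with h | h | ⟨a, ρ'', ha, heq, h⟩
    · simpa using eq_nil_of_prepend h
    · simpa using eq_nil_of_prepend h
    · obtain ⟨rfl, htail⟩ := Run.prepend_cons_inj heq
      rw [Run.prepend_nil] at htail
      rw [List.forall_mem_cons]
      exact ⟨ha, ih (htail ▸ h)⟩

/-! ### Restriction to runs that maintain an invariant -/

/-- The runs of `c` that start in `I` and stay in `I` (until `c` aborts). -/
def restrict (I : Set S) (c : Cmd S) : Cmd S where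
  runs σ := {Run.finite [] .incomplete} ∪ {ρ | σ ∈ I ∧ ((ρ ∈ c.runs σ ∧ ρ.StaysIn I) ∨
    ∃ s ρ', Run.finite s .aborted ∈ c.runs σ ∧ (∀ x ∈ s, x.2 ∈ I) ∧ ρ = Run.prepend s ρ')}
  start_mem _ := Or.inl rfl
  prefix_mem σ s ρ h := by
    rcases h with h | ⟨hσ, ⟨h, hI⟩ | ⟨s', ρ', h, hI, e⟩⟩
    · rw [eq_nil_of_prepend h]; exact Or.inl rfl
    · exact Or.inr ⟨hσ, Or.inl ⟨c.prefix_mem σ s ρ h,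
        Run.staysIn_finite.2 (Run.staysIn_prepend.1 hI).1⟩⟩
    · rcases Run.prepend_eq_prepend e with ⟨r, rfl, _⟩ | ⟨r, rfl, _⟩
      · exact Or.inr ⟨hσ, Or.inr ⟨s', .finite r .incomplete, h, hI, rfl⟩⟩
      · refine Or.inr ⟨hσ, Or.inl ⟨c.prefix_mem σ s (.finite r .aborted) h, ?_⟩⟩
        exact Run.staysIn_finite.2 fun x hx => hI x (List.mem_append_left r hx)
  abort_mem σ s ρ h := by
    rcases h with h | ⟨hσ, ⟨h, hI⟩ | ⟨s', ρ', h, hI, e⟩⟩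
    · simp at h
    · exact Or.inr ⟨hσ, Or.inr ⟨s, ρ, h, Run.staysIn_finite.1 hI, rfl⟩⟩
    · cases ρ' with
      | infinite f => simp [Run.prepend] at e
      | finite t x =>
        simp only [Run.prepend, Run.finite.injEq] at e
        exact Or.inr ⟨hσ, Or.inr ⟨s', Run.prepend t ρ, h, hI, by
          rw [e.1, Run.prepend_append]⟩⟩

theorem mem_restrict {I : Set S} {c : Cmd S} {σ : S} {ρ : Run S} (hσ : σ ∈ I)
    (h : ρ ∈ c.runs σ) (hI : ρ.StaysIn I) : ρ ∈ (restrict I c).runs σ :=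
  Or.inr ⟨hσ, Or.inl ⟨h, hI⟩⟩

/-- The extensions of aborted runs in `restrict I d` need no separate check: `c` is closed under
them once it contains the aborted run itself. -/
theorem restrict_le_iff {I : Set S} {c d : Cmd S} :
    restrict I d ≤ c ↔ ∀ σ ∈ I, ∀ ρ ∈ d.runs σ, ρ.StaysIn I → ρ ∈ c.runs σ := by
  constructor
  · exact fun h σ hσ ρ hρ hI => h σ (mem_restrict hσ hρ hI)
  · rintro h σ ρ (hρ | ⟨hσ, ⟨hρ, hI⟩ | ⟨s, ρ', hs, hI, rfl⟩⟩)
    · rw [Set.mem_singleton_iff.1 hρ]; exact c.start_mem σ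
    · exact h σ hσ ρ hρ hI
    · exact c.abort_mem σ s ρ' (h σ hσ _ hs (Run.staysIn_finite.2 hI))

theorem restrict_le (I : Set S) (c : Cmd S) : restrict I c ≤ c :=
  restrict_le_iff.2 fun _ _ _ h _ => h

theorem dataReif_of_restrict_le {I : Set S} {c d : Cmd S} (h : restrict I d ≤ c) :
    DataReif I c d := by
  rw [restrict_le_iff] at h
  intro σ ρ hρ
  by_cases hσ : σ ∈ I
  · rcases hρ with ⟨h1, h2⟩ | ⟨s, ρ', rfl, ⟨h1, _⟩ | ⟨h1, h2⟩⟩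
    · exact Or.inl ⟨h1, h σ hσ ρ h2 (staysIn_of_mem_promise ((mem_assert_seq_iff hσ).1 h1))⟩
    · exact absurd ((mem_assert_seq_iff hσ).1 h1) ((isAtomic_step _).aborted_notMem_iter s)
    -- Here `d` aborts after `s`. As `inv I` can perform `s`, the sequence stays in `I`, so `c`
    -- aborts after `s` too; what follows the abort may leave `I`.
    · refine Or.inr ⟨s, ρ', rfl, Or.inr ⟨h1, h σ hσ _ h2 ?_⟩⟩
      have hI := staysIn_of_mem_promise ((mem_assert_seq_iff hσ).1 h1)
      exact Run.staysIn_finite.2 (Run.staysIn_finite.1 hI)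
  · exact Or.inr ⟨[], ρ, (Run.prepend_nil ρ).symm,
      Or.inl ⟨mem_assert_seq_of_notMem hσ _ _, c.start_mem σ⟩⟩

/-! ### Compatibility of restriction with the operators. -/

theorem restrict_sup_le {I : Set S} {c₁ c₂ d₁ d₂ : Cmd S} (hc : restrict I c₂ ≤ c₁)
    (hd : restrict I d₂ ≤ d₁) : restrict I (c₂ ⊔ d₂) ≤ c₁ ⊔ d₁ := by
  rw [restrict_le_iff] at *
  rintro σ hσ ρ (h | h) hI
  · exact Or.inl (hc σ hσ ρ h hI)
  · exact Or.inr (hd σ hσ ρ h hI)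

theorem restrict_seq_le {I : Set S} {c₁ c₂ d₁ d₂ : Cmd S} (hc : restrict I c₂ ≤ c₁)
    (hd : restrict I d₂ ≤ d₁) : restrict I (c₂ ⨟ d₂) ≤ c₁ ⨟ d₁ := by
  rw [restrict_le_iff] at *
  rintro σ hσ ρ ((⟨h, h'⟩ | ⟨s, ρ', h, rfl⟩) | ⟨s, ρ', h, h', rfl⟩) hI
  · exact Or.inl (Or.inl ⟨hc σ hσ ρ h hI, h'⟩)
  · rw [Run.staysIn_prepend] at hI
    exact Or.inl (Or.inr ⟨s, ρ', hc σ hσ _ h (Run.staysIn_finite.2 hI.1), rfl⟩)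
  · rw [Run.staysIn_prepend] at hI
    exact Or.inr ⟨s, ρ', hc σ hσ _ h (Run.staysIn_finite.2 hI.1),
      hd _ (lastState_mem hσ hI.1) ρ' h' hI.2, rfl⟩

/-- Coinduction: `restrict I (iter c₂)` is a post-fixed point of `iterFun c₁`. Unfolding `iter c₂`
once and restricting both factors leaves the tail restricted, as required. -/
theorem restrict_iter_le {I : Set S} {c₁ c₂ : Cmd S} (hc : restrict I c₂ ≤ c₁) :
    restrict I (iter c₂) ≤ iter c₁ := by
  refine (iterFun c₁).le_gfp ?_
  have h : restrict I (nil ⊔ c₂ ⨟ iter c₂) ≤ nil ⊔ c₁ ⨟ restrict I (iter c₂) :=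
    restrict_sup_le (restrict_le I nil)
      (restrict_seq_le hc (d₁ := restrict I (iter c₂)) le_rfl)
  rwa [← iter_unfold] at h

theorem restrict_wconj_le {I : Set S} {c₁ c₂ d : Cmd S} (hc : restrict I c₂ ≤ c₁) :
    restrict I (c₂ ⋒ d) ≤ c₁ ⋒ d := by
  rw [restrict_le_iff] at *
  rintro σ hσ ρ (⟨h, h'⟩ | ⟨s, ρ', rfl, ⟨h, h'⟩ | ⟨h, h'⟩⟩) hI
  · exact Or.inl ⟨hc σ hσ ρ h hI, h'⟩
  · have hs : (Run.finite s .aborted).StaysIn I :=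
      Run.staysIn_finite.2 (Run.staysIn_prepend.1 hI).1
    exact Or.inr ⟨s, ρ', rfl, Or.inl ⟨hc σ hσ _ h hs, h'⟩⟩
  · have hs : (Run.finite s .incomplete).StaysIn I :=
      Run.staysIn_finite.2 (Run.staysIn_prepend.1 hI).1
    exact Or.inr ⟨s, ρ', rfl, Or.inr ⟨hc σ hσ _ h hs, h'⟩⟩

/-! ### The individual commands. -/

theorem restrict_test_le {I p₁ p₂ : Set S} (h : I ∩ p₂ ⊆ p₁) :
    restrict I (test p₂) ≤ test p₁ :=
  restrict_le_iff.2 fun _ hσ _ hρ _ => hρ.imp_right fun h' => ⟨h ⟨hσ, h'.1⟩, h'.2⟩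

theorem restrict_atom_le (k : Kind) {I : Set S} {r₁ r₂ : Set (S × S)}
    (h : preRel I ∩ r₂ ∩ postRel I ⊆ r₁) : restrict I (atom k r₂) ≤ atom k r₁ := by
  rw [restrict_le_iff]
  rintro σ hσ ρ (hρ | ⟨σ', hr, hρ⟩) hI
  · exact Or.inl hρ
  · have hσ' : σ' ∈ I := by
      rcases hρ with rfl | rfl <;> simpa using Run.staysIn_finite.1 hI
    exact Or.inr ⟨σ', h ⟨⟨hσ, hr⟩, hσ'⟩, hρ⟩

/-- The inclusion is reversed because an assertion aborts on the complement of its set. -/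
theorem restrict_assert_le {I p₁ p₂ : Set S} (h : I ∩ p₁ ⊆ p₂) :
    restrict I (assert p₂) ≤ assert p₁ :=
  restrict_sup_le (restrict_le I _) (restrict_seq_le
    (restrict_test_le fun _ hσ hp => hσ.2 (h ⟨hσ.1, hp⟩)) (restrict_le I _))

theorem restrict_guar_le {I : Set S} {g₁ g₂ : Set (S × S)}
    (h : preRel I ∩ g₂ ∩ postRel I ⊆ g₁) : restrict I (guar g₂) ≤ guar g₁ :=
  restrict_iter_le (restrict_sup_le (restrict_atom_le .prog h) (restrict_le I _))

theorem restrict_rely_le {I : Set S} {r₁ r₂ : Set (S × S)}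
    (h : preRel I ∩ r₁ ∩ postRel I ⊆ r₂) : restrict I (rely r₂) ≤ rely r₁ :=
  have hc : preRel I ∩ r₂ᶜ ∩ postRel I ⊆ r₁ᶜ :=
    fun _ hx hr => hx.1.2 (h ⟨⟨hx.1.1, hr⟩, hx.2⟩)
  restrict_iter_le (restrict_sup_le (restrict_le I _)
    (restrict_seq_le (restrict_atom_le .env hc) (restrict_le I _)))

theorem restrict_opt_le {I : Set S} {q₁ q₂ : Set (S × S)}
    (h : preRel I ∩ q₂ ∩ postRel I ⊆ q₁) : restrict I (opt q₂) ≤ opt q₁ :=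
  -- A stuttering pair from a state of `I` has both ends in `I`.
  have ht : I ∩ {σ | (σ, σ) ∈ q₂} ⊆ {σ | (σ, σ) ∈ q₁} :=
    fun _ hσ => h ⟨⟨hσ.1, hσ.2⟩, hσ.1⟩
  restrict_sup_le (restrict_atom_le .prog h) (restrict_test_le ht)

/-- From `σ`, the disjuncts with `σ₀ ≠ σ` fail their first test and contribute only the empty
observation. -/
theorem mem_post {q : Set (S × S)} {σ : S} {ρ : Run S} (h : ρ ∈ (post q).runs σ) :
    ρ ∈ (test {σ} ⨟ term ⨟ test {σ' | (σ, σ') ∈ q}).runs σ := by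
  rcases h with h | ⟨_, ⟨σ₀, rfl⟩, h⟩
  · rw [Set.mem_singleton_iff.1 h]; exact start_mem _ σ
  · by_cases hσ : σ = σ₀
    · subst hσ; exact h
    · have ht : ∀ ρ ∈ (test {σ₀}).runs σ, ρ = .finite [] .incomplete :=
        fun _ h => (eq_of_mem_test h).resolve_right fun h' => hσ h'.1
      have hs : ∀ ρ ∈ (test {σ₀} ⨟ term).runs σ, ρ = .finite [] .incomplete :=
        fun _ h => eq_of_mem_seq ht h
      rw [eq_of_mem_seq hs h]
      exact start_mem _ σ

theorem restrict_assert_post_le {I p : Set S} {q₁ q₂ : Set (S × S)}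
    (h : preRel I ∩ preRel p ∩ q₂ ∩ postRel I ⊆ q₁) :
    restrict I (assert (I ∩ p) ⨟ post q₂) ≤ assert p ⨟ post q₁ := by
  rw [restrict_le_iff]
  intro σ hσ ρ hρ hI
  by_cases hp : σ ∈ p
  · have hIp : σ ∈ I ∩ p := ⟨hσ, hp⟩
    rw [mem_assert_seq_iff hIp] at hρ
    rw [mem_assert_seq_iff hp]
    -- With the initial state fixed at `σ`, which lies in `I` and `p`, the hypothesis on relations
    -- becomes an inclusion between sets of final states.
    have hle : restrict I (test {σ} ⨟ term ⨟ test {σ' | (σ, σ') ∈ q₂}) ≤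
        test {σ} ⨟ term ⨟ test {σ' | (σ, σ') ∈ q₁} :=
      restrict_seq_le (restrict_le I _)
        (restrict_test_le fun σ' h' => h ⟨⟨⟨hσ, hp⟩, h'.2⟩, h'.1⟩)
    exact le_iSup (fun σ₀ : S => test {σ₀} ⨟ term ⨟ test {σ | (σ₀, σ) ∈ q₁}) σ σ
      (restrict_le_iff.1 hle σ hσ ρ (mem_post hρ) hI)
  · exact mem_assert_seq_of_notMem hp _ _

/-! ### Guarantees and weak conjunction -/

/-- Coinduction: a common run splits in both guarantees at the same first transition, which then
satisfies both relations if it is a program transition, and the tails are again common. -/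
theorem guar_inf_guar_le (g h : Set (S × S)) : guar g ⊓ guar h ≤ guar (g ∩ h) := by
  refine (iterFun _).le_gfp ?_
  rintro σ ρ ⟨hg, hh⟩
  rcases (isAtomic_guar g).mem_iter_cases hg with rfl | rfl | ⟨a, ρ', ha, rfl, hρ'⟩
  · exact start_mem _ σ
  · exact Or.inl (Or.inr ⟨trivial, rfl⟩)
  · rcases (isAtomic_guar h).mem_iter_cases hh with h1 | h1 | ⟨b, ρ'', hb, heq, hρ''⟩
    · simpa using eq_nil_of_prepend h1
    · simpa using eq_nil_of_prepend h1
    · obtain ⟨rfl, htail⟩ := Run.prepend_cons_inj heq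
      rw [Run.prepend_nil, Run.prepend_nil] at htail
      subst htail
      refine Or.inr (Or.inr ⟨[a], ρ', ?_, ⟨hρ', hρ''⟩, rfl⟩)
      obtain ⟨k, σ'⟩ := a
      cases k with
      | prog =>
        have hg' : (σ, σ') ∈ g := by simpa using ha
        have hh' : (σ, σ') ∈ h := by simpa using hb
        exact Or.inl (Or.inr ⟨σ', ⟨hg', hh'⟩, Or.inr rfl⟩)
      | env => exact Or.inr (Or.inr ⟨σ', trivial, Or.inr rfl⟩)

/-- Guarantees never abort, so between them weak conjunction is intersection, and any abort comes
from `c`. -/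
theorem guar_wconj_guar_wconj_le (g h : Set (S × S)) (c : Cmd S) :
    guar g ⋒ (guar h ⋒ c) ≤ guar (g ∩ h) ⋒ c := by
  have hle := guar_inf_guar_le g h
  rintro σ ρ (⟨hg, ⟨hh, hc⟩ | ⟨s, ρ', rfl, ⟨hh, _⟩ | ⟨hh, hc⟩⟩⟩ |
    ⟨s, ρ', rfl, ⟨hg, _⟩ | ⟨hg, ⟨hh, _⟩ | ⟨s', ρ'', heq, ⟨hh, _⟩ | ⟨hh, hc⟩⟩⟩⟩)
  · exact Or.inl ⟨hle σ ⟨hg, hh⟩, hc⟩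
  · exact absurd hh ((isAtomic_guar h).aborted_notMem_iter s)
  · exact Or.inr ⟨s, ρ', rfl, Or.inr ⟨hle σ ⟨prefix_mem _ σ s ρ' hg, hh⟩, hc⟩⟩
  · exact absurd hg ((isAtomic_guar g).aborted_notMem_iter s)
  · exact absurd hh ((isAtomic_guar h).aborted_notMem_iter s)
  · exact absurd hh ((isAtomic_guar h).aborted_notMem_iter s')
  -- The inner conjunction has already aborted at `s'`, an initial part of `s`; `guar g` allows `s`,
  -- hence also `s'`.
  · refine (guar (g ∩ h) ⋒ c).abort_mem σ s ρ'
      (Or.inr ⟨s', ρ'', heq, Or.inr ⟨hle σ ⟨?_, hh⟩, hc⟩⟩)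
    cases ρ'' with
    | infinite f => simp [Run.prepend] at heq
    | finite t e =>
      simp only [Run.prepend, Run.finite.injEq] at heq
      refine prefix_mem _ σ s' (.finite t .incomplete) ?_
      rw [Run.prepend, ← heq.1]
      exact hg

theorem restrict_frame_le {Var : Type u} {Val : Type v} {I : Set (State Var Val)}
    {x y : Set Var} {g : Set (State Var Val × State Var Val)}
    (h : preRel I ∩ g ∩ postRel I ⊆ idRel x) (c : Cmd (State Var Val)) :
    restrict I (guar g ⋒ frame (x ∪ y) c) ≤ frame y c := by
  -- A variable outside `y` is either in `x`, where `g` within `I` fixes it, or outside `x ∪ y`,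
  -- where the frame does.
  have hg : preRel I ∩ (g ∩ idRel (x ∪ y)ᶜ) ∩ postRel I ⊆ idRel yᶜ := by
    intro z hz a ha
    by_cases hx : a ∈ x
    · exact h ⟨⟨hz.1.1, hz.1.2.1⟩, hz.2⟩ a hx
    · exact hz.1.2.2 a fun h' => h'.elim hx ha
  have hle := restrict_le_iff.1 (restrict_wconj_le (d := c) (restrict_guar_le hg))
  exact restrict_le_iff.2 fun σ hσ ρ hρ hI =>
    hle σ hσ ρ (guar_wconj_guar_wconj_le g _ c σ hρ) hI

end Cmd

end RelyGuarantee

open RelyGuarantee RelyGuarantee.Cmd in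
theorem mainTheorem4 {Var : Type*} {Val : Type*} (I : Set (State Var Val)) :
    (∀ p₁ p₂ : Set (State Var Val), p₁ ⊇ I ∩ p₂ →
      DataReif I (test p₁) (test p₂)) ∧
    (∀ r₁ r₂ : Set (State Var Val × State Var Val), r₁ ⊇ preRel I ∩ r₂ ∩ postRel I →
      DataReif I (pstep r₁) (pstep r₂)) ∧
    (∀ r₁ r₂ : Set (State Var Val × State Var Val), r₁ ⊇ preRel I ∩ r₂ ∩ postRel I →
      DataReif I (estep r₁) (estep r₂)) ∧
    (∀ p₁ p₂ : Set (State Var Val), I ∩ p₁ ⊆ p₂ →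
      DataReif I (assert p₁) (assert p₂)) ∧
    (∀ g₁ g₂ : Set (State Var Val × State Var Val), g₁ ⊇ preRel I ∩ g₂ ∩ postRel I →
      DataReif I (guar g₁) (guar g₂)) ∧
    (∀ r₁ r₂ : Set (State Var Val × State Var Val), preRel I ∩ r₁ ∩ postRel I ⊆ r₂ →
      DataReif I (rely r₁) (rely r₂)) ∧
    (∀ (v w : Set Var) (g : Set (State Var Val × State Var Val)) (c : Cmd (State Var Val)),
      idRel v ⊇ preRel I ∩ g ∩ postRel I → v ≠ w →
      DataReif I (frame w c) (guar g ⋒ frame (v ∪ w) c)) ∧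
    (∀ q₁ q₂ : Set (State Var Val × State Var Val), q₁ ⊇ preRel I ∩ q₂ ∩ postRel I →
      DataReif I (opt q₁) (opt q₂)) ∧
    (∀ (p : Set (State Var Val)) (q₁ q₂ : Set (State Var Val × State Var Val)),
      q₁ ⊇ preRel I ∩ preRel p ∩ q₂ ∩ postRel I →
      DataReif I (assert p ⨟ post q₁) (assert (I ∩ p) ⨟ post q₂)) :=
  ⟨fun _ _ h => dataReif_of_restrict_le (restrict_test_le h),
    fun _ _ h => dataReif_of_restrict_le (restrict_atom_le .prog h),
    fun _ _ h => dataReif_of_restrict_le (restrict_atom_le .env h),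
    fun _ _ h => dataReif_of_restrict_le (restrict_assert_le h),
    fun _ _ h => dataReif_of_restrict_le (restrict_guar_le h),
    fun _ _ h => dataReif_of_restrict_le (restrict_rely_le h),
    fun _ _ _ c h _ => dataReif_of_restrict_le (restrict_frame_le h c),
    fun _ _ h => dataReif_of_restrict_le (restrict_opt_le h),
    fun _ _ _ h => dataReif_of_restrict_le (restrict_assert_post_le h)⟩
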